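/- Let $V$ be a finite-dimensional Euclidean space and let $W\subset O(V)$ be a finite real reflection group, that is, a finite group of orthogonal transformations generated by reflections. Let $T$ be the set of all reflections in $W$, and call a unit vector normal to the hyperplane fixed by some $t\in T$ a root. Let $S\subset T$ be a simple system of reflections for $W$, i.e. the set of reflections associated to a linearly independent set $\Delta$ of roots such that every root is a linear combination of elements of $\Delta$ with coefficients all $\ge 0$ or all $\le 0$. Let $\ell$ and $\ell_T$ be the word lengths on $W$ with respect to the generating sets $S$ and $T$. The Bruhat order $\le_B$ on $W$ is the reflexive and transitive closure of the relation "$vw^{-1}\in T$ and $\ell(v)<\ell(w)$"; we write $v>_B w$ if $w\le_B v$ and $v\ne w$. The absolute order on $W$ is defined by $v\le w$ if and only if $\ell_T(w)=\ell_T(v^{-1}w)+\ell_T(v)$. Let $c$ be a standard Coxeter element, i.e. the product of all the elements of $S$, each taken once, in some order. Let $NC(W,c)=\{w\in W : w\le c\}$ be the set of noncrossing partitions, ordered by the absolute order, with cover relation denoted by $\lessdot$. For $w\in NC(W,c)$ let $K(w)=w^{-1}c$ be its Kreweras complement. An element $w\in W$ has full support if every element of $S$ appears in some reduced expression of $w$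 in the alphabet $S$ (whether $s\in S$ appears does not depend on the chosen reduced expression). Let $v,w\in NC(W,c)$ with $v\lessdot w$. Then: (i) if $v>_B w$, then $K(v)>_B K(w)$; (ii) if moreover $v$ has full support, then $K(v)>_B K(w)$ implies $v>_B w$. -/

import Mathlib

open scoped NNReal

/-! ### Notions in a group with a distinguished generating set -/

section Group

variable {G : Type*} [Group G]

/-- A word in the alphabet `A` whose product is `g`. -/
def IsWordFor (A : Set G) (l : List G) (g : G) : Prop :=
  (∀ a ∈ l, a ∈ A) ∧ l.prod = g

/-- The least number of factors of an expression of `g` as a product of elements of `A`.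
It is used for sets `A` of involutions that generate the group. -/
noncomputable def wordLength (A : Set G) (g : G) : ℕ :=
  sInf {k : ℕ | ∃ l : List G, IsWordFor A l g ∧ l.length = k}

/-- A reduced expression of `g` in the alphabet `A`. -/
def IsReducedWordFor (A : Set G) (l : List G) (g : G) : Prop :=
  IsWordFor A l g ∧ l.length = wordLength A g

/-- The support of `g`: the elements of `S` which appear in some reduced expression of `g`. -/
def wordSupport (S : Set G) (g : G) : Set G :=
  {s | ∃ l : List G, IsReducedWordFor S l g ∧ s ∈ l}

/-- `g` has full support. -/
def HasFullSupport (S : Set G) (g : G) : Prop :=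
  wordSupport S g = S

/-- The relation generating the Bruhat order: `v w⁻¹ ∈ T` and `ℓ(v) < ℓ(w)`, where `ℓ` is
the length with respect to `S`. -/
def BruhatStep (S T : Set G) (v w : G) : Prop :=
  v * w⁻¹ ∈ T ∧ wordLength S v < wordLength S w

/-- The Bruhat order `v ≤_B w`. -/
def BruhatLE (S T : Set G) (v w : G) : Prop :=
  Relation.ReflTransGen (BruhatStep S T) v w

/-- The strict Bruhat order `v <_B w`. -/
def BruhatLT (S T : Set G) (v w : G) : Prop :=
  BruhatLE S T v w ∧ v ≠ w

/-- The absolute order `v ≤ w`, that is `ℓ_T(w) = ℓ_T(v⁻¹ w) + ℓ_T(v)`, where `ℓ_T` is the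
length with respect to `T`. -/
def AbsLE (T : Set G) (v w : G) : Prop :=
  wordLength T w = wordLength T (v⁻¹ * w) + wordLength T v

/-- The strict absolute order `v < w`. -/
def AbsLT (T : Set G) (v w : G) : Prop :=
  AbsLE T v w ∧ v ≠ w

/-- The noncrossing partitions associated to `c`. -/
def NC (T : Set G) (c : G) : Set G :=
  {w | AbsLE T w c}

/-- `w` covers `v` in the poset `NC T c`, ordered by the absolute order. -/
def NCCovBy (T : Set G) (c v w : G) : Prop :=
  v ∈ NC T c ∧ w ∈ NC T c ∧ AbsLT T v w ∧
    ∀ u ∈ NC T c, ¬ (AbsLT T v u ∧ AbsLT T u w)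

/-- The Kreweras complement `K(w) = w⁻¹ c`. -/
def kreweras (c w : G) : G :=
  w⁻¹ * c

/-- A standard Coxeter element: the product of all the elements of `S`, each of them occurring
exactly once, in some order. -/
def IsStandardCoxeterElement (S : Set G) (c : G) : Prop :=
  ∃ l : List G, l.Nodup ∧ (∀ s, s ∈ l ↔ s ∈ S) ∧ l.prod = c

end Group

/-! ### Finite real reflection groups -/

section Reflection

variable {V : Type*} [NormedAddCommGroup V] [InnerProductSpace ℝ V]

/-- The orthogonal reflection in the hyperplane normal to the (nonzero) vector `α`. -/
noncomputable def hyperplaneReflection (α : V) : V ≃ₗᵢ[ℝ] V :=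
  (Submodule.span ℝ {α})ᗮ.reflection

/-- The roots of `W`: the unit vectors normal to the hyperplane fixed by a reflection in `W`. -/
def rootSet (W : Subgroup (V ≃ₗᵢ[ℝ] V)) : Set V :=
  {α | ‖α‖ = 1 ∧ hyperplaneReflection α ∈ W}

/-- The set of all reflections in `W`. -/
def reflectionSet (W : Subgroup (V ≃ₗᵢ[ℝ] V)) : Set W :=
  {t | ∃ α ∈ rootSet W, (t : V ≃ₗᵢ[ℝ] V) = hyperplaneReflection α}

/-- `W` is a finite real reflection group: a finite group of orthogonal transformations which is
generated by reflections. -/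
structure IsFiniteReflectionGroup (W : Subgroup (V ≃ₗᵢ[ℝ] V)) : Prop where
  finite : Finite W
  closure_eq_top : Subgroup.closure (reflectionSet W) = ⊤

/-- `Δ` is a system of simple roots for `W`: a linearly independent set of roots such that each
root of `W` is a linear combination of `Δ` with coefficients all nonnegative or all
nonpositive. -/
structure IsSimpleRootSystem (W : Subgroup (V ≃ₗᵢ[ℝ] V)) (Δ : Set V) : Prop where
  subset_rootSet : Δ ⊆ rootSet W
  linearIndepOn : LinearIndepOn ℝ id Δ
  mem_or_neg_mem : ∀ β ∈ rootSet W,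
    β ∈ Submodule.span ℝ≥0 Δ ∨ -β ∈ Submodule.span ℝ≥0 Δ

/-- `S` is a simple system of reflections for `W`: the set of reflections associated to a system
of simple roots. -/
def IsSimpleSystem (W : Subgroup (V ≃ₗᵢ[ℝ] V)) (S : Set W) : Prop :=
  ∃ Δ : Set V, IsSimpleRootSystem W Δ ∧
    S = {s : W | ∃ α ∈ Δ, (s : V ≃ₗᵢ[ℝ] V) = hyperplaneReflection α}

end Reflection

/-! ### Word length in a group -/

section Words

variable {G : Type*} [Group G] {A : Set G}

/-! Everything is read off from signs of roots. A cover gives a reflection `t = w * v⁻¹` with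
positive root `β`; put `δ = v⁻¹ β`. Then `w <_B v` exactly when `δ` is negative. Also `K(w) = t' *
K(v)`, where `t'` is the reflection in `δ`, and `K(v)⁻¹ δ = c⁻¹ β`, so `K(w) <_B K(v)` exactly when
`δ` and `c⁻¹ β` have opposite signs. If `c⁻¹ β` is positive, the two conditions coincide.

If `c⁻¹ β` is negative, exchange deletes one simple reflection `s`, with root `α`, from the word of
`c`: the rest has product `t * c`, and `β` has `α`-coordinate 1. As `t * c = v * K(w)` with
reflection lengths adding up to at most the number of remaining letters, a dimension count puts the
roots of a reduced `T`-word of `v` in the span of the remaining simple roots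
(`IsSimpleRootSystem.apply_eq_of_mul_eq_prod`). So `v` preserves the `α`-coordinate. Then `δ` has
coordinate 1 and is positive, which excludes the hypothesis of (i); and `s` is not in the support of
`v`, which excludes the hypothesis of (ii). -/

theorem wordLength_le_length {l : List G} {g : G} (h : IsWordFor A l g) :
    wordLength A g ≤ l.length :=
  Nat.sInf_le ⟨l, h, rfl⟩

theorem exists_isReducedWordFor (hA : ∀ g : G, ∃ l, IsWordFor A l g) (g : G) :
    ∃ l, IsReducedWordFor A l g := by
  obtain ⟨l, hl⟩ := hA g
  obtain ⟨m, hm, hm'⟩ := Nat.sInf_mem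
    (s := {k : ℕ | ∃ l : List G, IsWordFor A l g ∧ l.length = k}) ⟨_, l, hl, rfl⟩
  exact ⟨m, hm, hm'⟩

theorem IsWordFor.append {l m : List G} {g h : G} (hl : IsWordFor A l g) (hm : IsWordFor A m h) :
    IsWordFor A (l ++ m) (g * h) := by
  refine ⟨fun a ha => ?_, by rw [List.prod_append, hl.2, hm.2]⟩
  rcases List.mem_append.1 ha with ha | ha
  exacts [hl.1 a ha, hm.1 a ha]

open scoped Pointwise in
theorem exists_isWordFor_of_closure_eq_top (hA : Subgroup.closure A = ⊤)
    (hinv : ∀ a ∈ A, a⁻¹ ∈ A) (g : G) : ∃ l, IsWordFor A l g := by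
  have hg : g ∈ Submonoid.closure (A ∪ A⁻¹) := by
    rw [← Subgroup.closure_toSubmonoid, hA]
    trivial
  obtain ⟨l, hl, hlg⟩ := Submonoid.exists_list_of_mem_closure hg
  refine ⟨l, fun a ha => ?_, hlg⟩
  rcases hl a ha with h | h
  · exact h
  · simpa using hinv _ h

theorem wordLength_mul_le (hA : ∀ g : G, ∃ l, IsWordFor A l g) (g h : G) :
    wordLength A (g * h) ≤ wordLength A g + wordLength A h := by
  obtain ⟨l, hl, hl'⟩ := exists_isReducedWordFor hA g
  obtain ⟨m, hm, hm'⟩ := exists_isReducedWordFor hA h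
  rw [← hl', ← hm', ← List.length_append]
  exact wordLength_le_length (hl.append hm)

/-- Additivity of lengths from `v` to `w` leaves no slack, so every triangle inequality through `v *
a` is an equality. -/
theorem absLE_of_isReducedWordFor_cons (hA : ∀ g : G, ∃ l, IsWordFor A l g) {v w a : G}
    {l : List G} (hvw : AbsLE A v w) (hl : IsReducedWordFor A (a :: l) (v⁻¹ * w)) :
    wordLength A (v * a) = wordLength A v + 1 ∧ wordLength A ((v * a)⁻¹ * w) = l.length ∧
      AbsLE A v (v * a) ∧ AbsLE A (v * a) w := by
  have ha : wordLength A a ≤ 1 :=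
    wordLength_le_length (l := [a]) ⟨by simpa using hl.1.1 a (by simp), by simp⟩
  have hl1 : wordLength A ((v * a)⁻¹ * w) ≤ l.length := by
    refine wordLength_le_length ⟨fun b hb => hl.1.1 b (by simp [hb]), ?_⟩
    have := hl.1.2
    rw [List.prod_cons] at this
    rw [mul_inv_rev, mul_assoc, ← this, inv_mul_cancel_left]
  have h1 := wordLength_mul_le hA v a
  have h2 := wordLength_mul_le hA (v * a) ((v * a)⁻¹ * w)
  have h3 := hl.2
  rw [mul_inv_cancel_left] at h2
  rw [List.length_cons] at h3
  simp only [AbsLE, inv_mul_cancel_left] at hvw ⊢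
  have h4 := wordLength_mul_le hA a ((v * a)⁻¹ * w)
  rw [mul_inv_rev, mul_assoc, mul_inv_cancel_left, ← mul_assoc, ← mul_inv_rev] at h4
  omega

theorem AbsLE.trans (hA : ∀ g : G, ∃ l, IsWordFor A l g) {u v w : G} (huv : AbsLE A u v)
    (hvw : AbsLE A v w) : AbsLE A u w := by
  have h1 := wordLength_mul_le hA (u⁻¹ * v) (v⁻¹ * w)
  have h2 := wordLength_mul_le hA u (u⁻¹ * w)
  rw [mul_assoc, mul_inv_cancel_left] at h1
  rw [mul_inv_cancel_left] at h2
  simp only [AbsLE] at *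
  omega

/-- A cover in the poset of noncrossing partitions is given by one factor of `A`. -/
theorem NCCovBy.exists_eq_mul (hA : ∀ g : G, ∃ l, IsWordFor A l g) {c v w : G}
    (h : NCCovBy A c v w) :
    v⁻¹ * w ∈ A ∧ wordLength A w = wordLength A v + 1 := by
  obtain ⟨-, hw, ⟨hle, hne⟩, hcov⟩ := h
  obtain ⟨l, hl⟩ := exists_isReducedWordFor hA (v⁻¹ * w)
  match l, hl with
  | [], hl => exact absurd (inv_mul_eq_one.1 hl.1.2.symm) hne
  | [a], hl =>
    have h1 : a = v⁻¹ * w := by simpa using hl.1.2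
    refine ⟨h1 ▸ hl.1.1 a (by simp), ?_⟩
    have h2 := hl.2
    simp only [AbsLE, List.length_singleton] at hle h2
    omega
  -- With two or more letters, `v * a` would lie strictly between `v` and `w`.
  | a :: b :: l, hl =>
    obtain ⟨h1, h2, h3, h4⟩ := absLE_of_isReducedWordFor_cons hA hle hl
    refine absurd ⟨⟨h3, fun e => ?_⟩, h4, fun e => ?_⟩ (hcov (v * a) (h4.trans hA hw))
    · rw [← e] at h1
      omega
    · have h5 : wordLength A ((v * a)⁻¹ * w) ≤ ([] : List G).length :=
        wordLength_le_length ⟨by simp, by simp [e]⟩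
      rw [h2] at h5
      simp at h5

theorem BruhatLT.wordLength_lt {S T : Set G} {v w : G} (h : BruhatLT S T v w) :
    wordLength S v < wordLength S w := by
  obtain ⟨hle, hne⟩ := h
  have key : ∀ {a b : G}, Relation.ReflTransGen (BruhatStep S T) a b →
      a = b ∨ wordLength S a < wordLength S b := by
    intro a b hab
    induction hab with
    | refl => exact Or.inl rfl
    | tail _ hs ih =>
      rcases ih with rfl | ih
      exacts [Or.inr hs.2, Or.inr (ih.trans hs.2)]
  exact (key hle).resolve_left hne

/-- With `BruhatLT.wordLength_lt`, this reduces Bruhat comparison of elements differing by a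
reflection to comparison of lengths. -/
theorem bruhatLT_of_wordLength_lt {S T : Set G} {v w : G} (ht : v * w⁻¹ ∈ T)
    (h : wordLength S v < wordLength S w) : BruhatLT S T v w :=
  ⟨.single ⟨ht, h⟩, fun e => by simp [e] at h⟩

end Words

/-! ### Reflections and roots -/

section Roots

variable {V : Type*} [NormedAddCommGroup V] [InnerProductSpace ℝ V]

theorem hyperplaneReflection_apply {α : V} (hα : ‖α‖ = 1) (x : V) :
    hyperplaneReflection α x = x - (2 * inner ℝ α x) • α := by
  rw [hyperplaneReflection, Submodule.reflection_orthogonal_apply,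
    Submodule.reflection_singleton_apply, hα]
  simp [mul_smul, two_smul]

theorem hyperplaneReflection_eq_self_iff {α : V} (hα : ‖α‖ = 1) (x : V) :
    hyperplaneReflection α x = x ↔ inner ℝ α x = 0 := by
  have h : α ≠ 0 := fun h => by simp [h] at hα
  rw [hyperplaneReflection_apply hα, sub_eq_self, smul_eq_zero, or_iff_left h]
  simp

theorem hyperplaneReflection_self {α : V} (hα : ‖α‖ = 1) : hyperplaneReflection α α = -α := by
  rw [hyperplaneReflection_apply hα, real_inner_self_eq_norm_sq, hα, two_mul, add_smul]
  simp

theorem hyperplaneReflection_mul_self (α : V) :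
    hyperplaneReflection α * hyperplaneReflection α = 1 :=
  Submodule.reflection_mul_reflection _

theorem hyperplaneReflection_inv (α : V) :
    (hyperplaneReflection α)⁻¹ = hyperplaneReflection α :=
  inv_eq_of_mul_eq_one_left (hyperplaneReflection_mul_self α)

theorem hyperplaneReflection_neg (α : V) : hyperplaneReflection (-α) = hyperplaneReflection α := by
  have h : Submodule.span ℝ {-α} = Submodule.span ℝ {α} := by
    rw [← Set.neg_singleton, Submodule.span_neg]
  simp only [hyperplaneReflection, h]

theorem hyperplaneReflection_map {α : V} (hα : ‖α‖ = 1) (g : V ≃ₗᵢ[ℝ] V) :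
    hyperplaneReflection (g α) = g * hyperplaneReflection α * g⁻¹ := by
  ext x
  have h : inner ℝ (g α) x = inner ℝ α (g⁻¹ x) := by
    rw [← g.inner_map_map α (g⁻¹ x)]
    congr 1
    exact (g.apply_symm_apply x).symm
  have hx : g (g⁻¹ x) = x := g.apply_symm_apply x
  change _ = g (hyperplaneReflection α (g⁻¹ x))
  rw [hyperplaneReflection_apply (by rw [g.norm_map, hα]), hyperplaneReflection_apply hα, map_sub,
    map_smul, h, hx]

/-! ### The group acting on its roots, and coordinates with respect to simple roots. -/

variable {W : Subgroup (V ≃ₗᵢ[ℝ] V)} {Δ : Set V}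

theorem coe_mul_apply (g h : W) (x : V) :
    ((g * h : W) : V ≃ₗᵢ[ℝ] V) x = (g : V ≃ₗᵢ[ℝ] V) ((h : V ≃ₗᵢ[ℝ] V) x) :=
  rfl

theorem coe_inv_apply_eq_iff (g : W) (x y : V) :
    ((g⁻¹ : W) : V ≃ₗᵢ[ℝ] V) x = y ↔ x = (g : V ≃ₗᵢ[ℝ] V) y :=
  (g : V ≃ₗᵢ[ℝ] V).symm_apply_eq

theorem map_mem_rootSet {α : V} (hα : α ∈ rootSet W) (g : W) :
    (g : V ≃ₗᵢ[ℝ] V) α ∈ rootSet W := by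
  refine ⟨by rw [LinearIsometryEquiv.norm_map, hα.1], ?_⟩
  rw [hyperplaneReflection_map hα.1]
  exact W.mul_mem (W.mul_mem g.2 hα.2) (W.inv_mem g.2)

theorem neg_mem_rootSet {α : V} (hα : α ∈ rootSet W) : -α ∈ rootSet W :=
  ⟨by rw [norm_neg, hα.1], by rw [hyperplaneReflection_neg]; exact hα.2⟩

theorem inv_mem_reflectionSet {t : W} (ht : t ∈ reflectionSet W) : t⁻¹ ∈ reflectionSet W := by
  obtain ⟨α, hα, h⟩ := ht
  exact ⟨α, hα, by rw [Subgroup.coe_inv, h, hyperplaneReflection_inv]⟩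

theorem conj_mem_reflectionSet {t : W} (ht : t ∈ reflectionSet W) (g : W) :
    g * t * g⁻¹ ∈ reflectionSet W := by
  obtain ⟨α, hα, h⟩ := ht
  exact ⟨_, map_mem_rootSet hα g, by simp [h, hyperplaneReflection_map hα.1]⟩

/-- The reflections attached to a set of vectors. -/
def simpleReflections (W : Subgroup (V ≃ₗᵢ[ℝ] V)) (Δ : Set V) : Set W :=
  {s : W | ∃ α ∈ Δ, (s : V ≃ₗᵢ[ℝ] V) = hyperplaneReflection α}

/-- `f` is a family of coordinate functionals for the set `Δ`. -/
def IsDualFamily (Δ : Set V) (f : V → V →ₗ[ℝ] ℝ) : Prop :=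
  (∀ α ∈ Δ, f α α = 1) ∧ ∀ α ∈ Δ, ∀ β ∈ Δ, α ≠ β → f α β = 0

theorem exists_isDualFamily (hΔ : LinearIndepOn ℝ id Δ) : ∃ f, IsDualFamily Δ f := by
  classical
  let b := Module.Basis.extend hΔ
  have hsub := hΔ.subset_extend (Set.subset_univ _)
  have hb : ∀ α (h : α ∈ Δ), b ⟨α, hsub h⟩ = α := fun α h => Module.Basis.extend_apply_self hΔ _
  refine ⟨fun α => if h : α ∈ Δ then b.coord ⟨α, hsub h⟩ else 0, fun α h => ?_,
    fun α h β h' hne => ?_⟩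
  · simp only [h, dite_true]
    have := b.repr_self ⟨α, hsub h⟩
    rw [hb α h] at this
    simp [this]
  · simp only [h, dite_true]
    rw [← hb β h']
    simp [hne.symm]

/-- Each letter moves a vector by a multiple of its root. -/
theorem sub_mem_span_of_word {l : List W} {R : List V}
    (h : ∀ t ∈ l, ∃ α ∈ R, ‖α‖ = 1 ∧ (t : V ≃ₗᵢ[ℝ] V) = hyperplaneReflection α) (x : V) :
    (l.prod : V ≃ₗᵢ[ℝ] V) x - x ∈ Submodule.span ℝ {α | α ∈ R} := by
  induction l with
  | nil => simp
  | cons t l ih =>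
    obtain ⟨α, hα, hn, ht⟩ := h t (by simp)
    have h1 := ih fun s hs => h s (by simp [hs])
    have h2 : ((t :: l).prod : V ≃ₗᵢ[ℝ] V) x - x = ((l.prod : V ≃ₗᵢ[ℝ] V) x - x) -
        (2 * inner ℝ α ((l.prod : V ≃ₗᵢ[ℝ] V) x)) • α := by
      rw [List.prod_cons, coe_mul_apply, ht,
        hyperplaneReflection_apply hn]
      abel
    rw [h2]
    exact sub_mem h1 (Submodule.smul_mem _ _ (Submodule.subset_span hα))

theorem apply_eq_self_of_word {l : List W} {R : List V}
    (h : ∀ t ∈ l, ∃ α ∈ R, ‖α‖ = 1 ∧ (t : V ≃ₗᵢ[ℝ] V) = hyperplaneReflection α) {x : V}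
    (hx : ∀ α ∈ R, inner ℝ α x = 0) : (l.prod : V ≃ₗᵢ[ℝ] V) x = x := by
  induction l with
  | nil => simp
  | cons t l ih =>
    obtain ⟨α, hα, hn, ht⟩ := h t (by simp)
    rw [List.prod_cons, coe_mul_apply,
      ih fun s hs => h s (by simp [hs]), ht, hyperplaneReflection_apply hn, hx α hα]
    simp

/-- The roots of the letters of a word, in order. -/
theorem exists_list_roots {Φ : Set V} {l : List W}
    (h : ∀ t ∈ l, ∃ α ∈ Φ, (t : V ≃ₗᵢ[ℝ] V) = hyperplaneReflection α) :
    ∃ R : List V, (∀ α ∈ R, α ∈ Φ) ∧ R.map hyperplaneReflection = l.map Subtype.val := by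
  choose! r hr hr' using h
  refine ⟨l.map r, fun α hα => ?_, ?_⟩
  · obtain ⟨t, ht, rfl⟩ := List.mem_map.1 hα
    exact hr t ht
  · rw [List.map_map]
    exact List.map_congr_left fun t ht => (hr' t ht).symm

theorem exists_height (hΔ : LinearIndepOn ℝ id Δ) : ∃ h : V →ₗ[ℝ] ℝ, ∀ α ∈ Δ, h α = 1 := by
  let b := Module.Basis.extend hΔ
  have hsub := hΔ.subset_extend (Set.subset_univ _)
  refine ⟨b.constr ℝ fun _ => 1, fun α h => ?_⟩
  have hb : b ⟨α, hsub h⟩ = α := Module.Basis.extend_apply_self hΔ _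
  conv_lhs => rw [← hb]
  exact b.constr_basis ℝ _ _

/-! ### Positive roots. -/

variable {f : V → V →ₗ[ℝ] ℝ}

theorem IsDualFamily.nonneg (hf : IsDualFamily Δ f) {α x : V} (hα : α ∈ Δ)
    (hx : x ∈ Submodule.span ℝ≥0 Δ) : 0 ≤ f α x := by
  induction hx using Submodule.span_induction with
  | mem y hy =>
    by_cases h : α = y
    · rw [← h, hf.1 α hα]; exact zero_le_one
    · rw [hf.2 α hα y hy h]
  | zero => simp
  | add y z _ _ h1 h2 => rw [map_add]; exact add_nonneg h1 h2
  | smul a y _ h =>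
    rw [NNReal.smul_def, map_smul]
    exact smul_nonneg a.2 h

/-- A positive coordinate away from `α` is unchanged by the reflection in `α`, and one positive
coordinate decides the sign of a root. -/
theorem IsDualFamily.eq_smul_or_exists_pos (hf : IsDualFamily Δ f) {α x : V}
    (hx : x ∈ Submodule.span ℝ≥0 Δ) :
    (∃ a : ℝ≥0, x = a • α) ∨ ∃ γ ∈ Δ, γ ≠ α ∧ 0 < f γ x := by
  induction hx using Submodule.span_induction with
  | mem y hy =>
    by_cases h : y = α
    · exact Or.inl ⟨1, by rw [one_smul, h]⟩
    · exact Or.inr ⟨y, hy, h, by rw [hf.1 y hy]; exact zero_lt_one⟩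
  | zero => exact Or.inl ⟨0, by rw [zero_smul]⟩
  | add y z hy hz h1 h2 =>
    rcases h1 with ⟨a, rfl⟩ | ⟨γ, hγ, hne, h1⟩
    · rcases h2 with ⟨b, rfl⟩ | ⟨γ, hγ, hne, h2⟩
      · exact Or.inl ⟨a + b, by rw [add_smul]⟩
      · exact Or.inr ⟨γ, hγ, hne, by rw [map_add]; exact add_pos_of_nonneg_of_pos (hf.nonneg hγ hy) h2⟩
    · exact Or.inr ⟨γ, hγ, hne, by rw [map_add]; exact add_pos_of_pos_of_nonneg h1 (hf.nonneg hγ hz)⟩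
  | smul a y _ h =>
    rcases h with ⟨b, rfl⟩ | ⟨γ, hγ, hne, h⟩
    · exact Or.inl ⟨a * b, by rw [mul_smul]⟩
    · rcases eq_or_ne a 0 with rfl | ha
      · exact Or.inl ⟨0, by rw [zero_smul, zero_smul]⟩
      · refine Or.inr ⟨γ, hγ, hne, ?_⟩
        rw [NNReal.smul_def, map_smul]
        exact smul_pos (NNReal.coe_pos.2 (pos_iff_ne_zero.2 ha)) h

theorem IsSimpleRootSystem.mem_span_of_pos (hΔ : IsSimpleRootSystem W Δ) (hf : IsDualFamily Δ f)
    {β γ : V} (hβ : β ∈ rootSet W) (hγ : γ ∈ Δ) (h : 0 < f γ β) :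
    β ∈ Submodule.span ℝ≥0 Δ := by
  refine (hΔ.mem_or_neg_mem β hβ).resolve_right fun h' => ?_
  have := hf.nonneg hγ h'
  rw [map_neg] at this
  linarith

theorem IsDualFamily.apply_reflection (hf : IsDualFamily Δ f) {α γ : V} (hα : α ∈ Δ) (hγ : γ ∈ Δ)
    (hne : γ ≠ α) (hn : ‖α‖ = 1) (x : V) : f γ (hyperplaneReflection α x) = f γ x := by
  rw [hyperplaneReflection_apply hn, map_sub, map_smul, hf.2 γ hγ α hα hne, smul_zero, sub_zero]

/-- A simple reflection permutes the positive roots other than its simple root. -/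
theorem IsSimpleRootSystem.reflection_mem_span (hΔ : IsSimpleRootSystem W Δ)
    (hf : IsDualFamily Δ f) {α β : V} (hα : α ∈ Δ) (hβ : β ∈ rootSet W)
    (hβ' : β ∈ Submodule.span ℝ≥0 Δ) (hne : β ≠ α) :
    hyperplaneReflection α β ∈ Submodule.span ℝ≥0 Δ := by
  have hα' := hΔ.subset_rootSet hα
  rcases hf.eq_smul_or_exists_pos (α := α) hβ' with ⟨a, rfl⟩ | ⟨γ, hγ, hγα, h⟩
  · refine absurd ?_ hne
    have h1 := hβ.1
    rw [NNReal.smul_def, norm_smul, hα'.1, mul_one, NNReal.norm_eq] at h1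
    rw [NNReal.smul_def, h1, one_smul]
  · refine hΔ.mem_span_of_pos hf (map_mem_rootSet hβ ⟨_, hα'.2⟩) hγ ?_
    rw [hf.apply_reflection hα hγ hγα hα'.1]
    exact h

theorem IsDualFamily.neg_notMem_span (hf : IsDualFamily Δ f) {β : V} (hβ : β ∈ rootSet W)
    (hβ' : β ∈ Submodule.span ℝ≥0 Δ) : -β ∉ Submodule.span ℝ≥0 Δ := by
  intro h
  rcases hf.eq_smul_or_exists_pos (α := 0) hβ' with ⟨a, rfl⟩ | ⟨γ, hγ, -, h1⟩
  · have := hβ.1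
    simp at this
  · have := hf.nonneg hγ h
    rw [map_neg] at this
    linarith

/-! ### Generation by simple reflections, and exchange. -/

theorem IsSimpleRootSystem.reflectionSet_subset_closure (hΔ : IsSimpleRootSystem W Δ)
    (hf : IsDualFamily Δ f) (hW : Finite W) {t : W} {β : V} (hβ : β ∈ rootSet W)
    (hβ' : β ∈ Submodule.span ℝ≥0 Δ) (ht : (t : V ≃ₗᵢ[ℝ] V) = hyperplaneReflection β) :
    t ∈ Subgroup.closure (simpleReflections W Δ) := by
  obtain ⟨h, hh⟩ := exists_height hΔ.linearIndepOn
  obtain ⟨g, ⟨hg, hgβ⟩, hmin⟩ := Set.exists_min_image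
    {g : W | g ∈ Subgroup.closure (simpleReflections W Δ) ∧
      (g : V ≃ₗᵢ[ℝ] V) β ∈ Submodule.span ℝ≥0 Δ} (fun g => h ((g : V ≃ₗᵢ[ℝ] V) β))
    (Set.toFinite _) ⟨1, one_mem _, hβ'⟩
  set β' := (g : V ≃ₗᵢ[ℝ] V) β with hβ'def
  have hroot : β' ∈ rootSet W := map_mem_rootSet hβ g
  have hmem : β' ∈ Δ := by
    by_contra hmem
    -- A non-simple `β'` stays positive under simple reflections, so minimality of its height forces
    -- these signs. Since `β'` is a nonnegative combination of `Δ`, its squared norm would be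
    -- nonpositive.
    have h1 : ∀ α ∈ Δ, inner ℝ α β' ≤ 0 := by
      intro α hα
      have hα' := hΔ.subset_rootSet hα
      have h2 := hΔ.reflection_mem_span hf hα hroot hgβ fun e => hmem (e ▸ hα)
      have h3 := hmin (⟨hyperplaneReflection α, hα'.2⟩ * g)
        ⟨mul_mem (Subgroup.subset_closure ⟨α, hα, rfl⟩) hg, by exact h2⟩
      rw [coe_mul_apply, ← hβ'def] at h3
      change _ ≤ h (hyperplaneReflection α β') at h3
      rw [hyperplaneReflection_apply hα'.1, map_sub, map_smul, hh α hα, smul_eq_mul] at h3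
      linarith
    have h2 : ∀ x ∈ Submodule.span ℝ≥0 Δ, inner ℝ x β' ≤ 0 := by
      intro x hx
      induction hx using Submodule.span_induction with
      | mem y hy => exact h1 y hy
      | zero => simp
      | add y z _ _ h1 h2 => rw [inner_add_left]; exact add_nonpos h1 h2
      | smul a y _ h =>
        rw [NNReal.smul_def, real_inner_smul_left]
        exact mul_nonpos_of_nonneg_of_nonpos a.2 h
    have h3 := h2 β' hgβ
    rw [real_inner_self_eq_norm_sq, hroot.1] at h3
    norm_num at h3
  have h1 : g * t * g⁻¹ ∈ Subgroup.closure (simpleReflections W Δ) := by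
    refine Subgroup.subset_closure ⟨β', hmem, ?_⟩
    rw [hβ'def, hyperplaneReflection_map hβ.1, ← ht]
    rfl
  have h2 := mul_mem (mul_mem (inv_mem hg) h1) hg
  simpa [mul_assoc] using h2

theorem mem_span_or_of_mem_reflectionSet (hΔ : IsSimpleRootSystem W Δ) {t : W}
    (ht : t ∈ reflectionSet W) :
    ∃ β ∈ rootSet W, β ∈ Submodule.span ℝ≥0 Δ ∧ (t : V ≃ₗᵢ[ℝ] V) = hyperplaneReflection β := by
  obtain ⟨β, hβ, h⟩ := ht
  rcases hΔ.mem_or_neg_mem β hβ with h' | h'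
  · exact ⟨β, hβ, h', h⟩
  · exact ⟨-β, neg_mem_rootSet hβ, h', by rw [hyperplaneReflection_neg, h]⟩

theorem IsSimpleRootSystem.exists_isWordFor (hΔ : IsSimpleRootSystem W Δ)
    (hf : IsDualFamily Δ f) (hW : IsFiniteReflectionGroup W) (g : W) :
    ∃ l, IsWordFor (simpleReflections W Δ) l g := by
  refine exists_isWordFor_of_closure_eq_top ?_ ?_ g
  · rw [eq_top_iff, ← hW.closure_eq_top, Subgroup.closure_le]
    intro t ht
    obtain ⟨β, hβ, hβ', h⟩ := mem_span_or_of_mem_reflectionSet hΔ ht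
    exact hΔ.reflectionSet_subset_closure hf hW.finite hβ hβ' h
  · rintro s ⟨α, hα, h⟩
    exact ⟨α, hα, by rw [Subgroup.coe_inv, h, hyperplaneReflection_inv]⟩

/-- The exchange property in terms of roots. -/
theorem IsSimpleRootSystem.exists_eq_append (hΔ : IsSimpleRootSystem W Δ)
    (hf : IsDualFamily Δ f) {l : List W} (hl : ∀ s ∈ l, s ∈ simpleReflections W Δ) {β : V}
    (hβ : β ∈ rootSet W) (hβ' : β ∈ Submodule.span ℝ≥0 Δ)
    (h : -(((l.prod)⁻¹ : W) : V ≃ₗᵢ[ℝ] V) β ∈ Submodule.span ℝ≥0 Δ) :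
    ∃ (l₁ : List W) (s : W) (l₂ : List W), l = l₁ ++ s :: l₂ ∧ ∃ α ∈ Δ, (s : V ≃ₗᵢ[ℝ] V) = hyperplaneReflection α ∧
      β = (l₁.prod : V ≃ₗᵢ[ℝ] V) α := by
  induction l generalizing β with
  | nil => exact absurd (by simpa using h) (hf.neg_notMem_span hβ hβ')
  | cons s l ih =>
    obtain ⟨α, hα, hs⟩ := hl s (by simp)
    by_cases hne : β = α
    · exact ⟨[], s, l, rfl, α, hα, hs, by simpa using hne⟩
    · have hss : s⁻¹ = s := Subtype.ext (by rw [Subgroup.coe_inv, hs, hyperplaneReflection_inv])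
      have h1 := hΔ.reflection_mem_span hf hα hβ hβ' hne
      rw [← hs] at h1
      rw [List.prod_cons, mul_inv_rev, coe_mul_apply, hss] at h
      obtain ⟨l₁, s', l₂, hl', α', hα', hs', h2⟩ :=
        ih (fun a ha => hl a (by simp [ha])) (map_mem_rootSet hβ s) h1 h
      refine ⟨s :: l₁, s', l₂, by rw [hl', List.cons_append], α', hα', hs', ?_⟩
      rw [List.prod_cons, coe_mul_apply, ← h2, ← coe_inv_apply_eq_iff, hss]

theorem mul_prod_eq_of_root {l₁ l₂ : List W} {s t : W} {α β : V} (hα : ‖α‖ = 1)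
    (hs : (s : V ≃ₗᵢ[ℝ] V) = hyperplaneReflection α)
    (ht : (t : V ≃ₗᵢ[ℝ] V) = hyperplaneReflection β) (hβ : β = (l₁.prod : V ≃ₗᵢ[ℝ] V) α) :
    t * (l₁ ++ s :: l₂).prod = (l₁ ++ l₂).prod := by
  have h1 : t = l₁.prod * s * (l₁.prod)⁻¹ := Subtype.ext (by
    rw [ht, hβ, hyperplaneReflection_map hα, ← hs]; rfl)
  have h2 : s * s = 1 := Subtype.ext (by
    rw [Subgroup.coe_mul, hs, hyperplaneReflection_mul_self]; rfl)
  rw [h1, List.prod_append, List.prod_append, List.prod_cons]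
  simp only [mul_assoc, inv_mul_cancel_left]
  rw [← mul_assoc s s, h2, one_mul]

/-! ### Lengths, signs of roots, and supports. -/

theorem IsSimpleRootSystem.wordLength_mul_lt (hΔ : IsSimpleRootSystem W Δ)
    (hf : IsDualFamily Δ f) (hW : IsFiniteReflectionGroup W) {t g : W} {β : V}
    (hβ : β ∈ rootSet W) (hβ' : β ∈ Submodule.span ℝ≥0 Δ)
    (ht : (t : V ≃ₗᵢ[ℝ] V) = hyperplaneReflection β)
    (h : -((g⁻¹ : W) : V ≃ₗᵢ[ℝ] V) β ∈ Submodule.span ℝ≥0 Δ) :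
    wordLength (simpleReflections W Δ) (t * g) < wordLength (simpleReflections W Δ) g := by
  obtain ⟨l, hl, hlen⟩ := exists_isReducedWordFor (hΔ.exists_isWordFor hf hW) g
  rw [← hl.2] at h
  obtain ⟨l₁, s, l₂, rfl, α, hα, hs, h1⟩ := hΔ.exists_eq_append hf hl.1 hβ hβ' h
  rw [← hlen, ← hl.2, mul_prod_eq_of_root (hΔ.subset_rootSet hα).1 hs ht h1]
  refine (wordLength_le_length ⟨fun a ha => hl.1 a ?_, rfl⟩).trans_lt (by simp)
  simp only [List.mem_append, List.mem_cons] at ha ⊢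
  tauto

/-- This is the previous case applied to `t * g`, because `t` negates `β`. -/
theorem IsSimpleRootSystem.wordLength_lt_mul (hΔ : IsSimpleRootSystem W Δ)
    (hf : IsDualFamily Δ f) (hW : IsFiniteReflectionGroup W) {t g : W} {β : V}
    (hβ : β ∈ rootSet W) (hβ' : β ∈ Submodule.span ℝ≥0 Δ)
    (ht : (t : V ≃ₗᵢ[ℝ] V) = hyperplaneReflection β)
    (h : ((g⁻¹ : W) : V ≃ₗᵢ[ℝ] V) β ∈ Submodule.span ℝ≥0 Δ) :
    wordLength (simpleReflections W Δ) g < wordLength (simpleReflections W Δ) (t * g) := by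
  have htt : t * t = 1 := Subtype.ext (by
    rw [Subgroup.coe_mul, ht, hyperplaneReflection_mul_self]; rfl)
  have h1 : -(((t * g)⁻¹ : W) : V ≃ₗᵢ[ℝ] V) β ∈ Submodule.span ℝ≥0 Δ := by
    rw [mul_inv_rev, inv_eq_of_mul_eq_one_left htt, coe_mul_apply, ht,
      hyperplaneReflection_self hβ.1, map_neg, neg_neg]
    exact h
  have h2 := hΔ.wordLength_mul_lt hf hW hβ hβ' ht h1
  rwa [← mul_assoc, htt, one_mul] at h2

/-- A word not containing a simple reflection preserves the corresponding coordinate. -/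
theorem IsSimpleRootSystem.apply_prod (hΔ : IsSimpleRootSystem W Δ) (hf : IsDualFamily Δ f)
    {l : List W} (hl : ∀ s ∈ l, s ∈ simpleReflections W Δ) {s : W} {α : V} (hα : α ∈ Δ)
    (hs : (s : V ≃ₗᵢ[ℝ] V) = hyperplaneReflection α) (hsl : s ∉ l) (x : V) :
    f α ((l.prod : V ≃ₗᵢ[ℝ] V) x) = f α x := by
  induction l with
  | nil => simp
  | cons r l ih =>
    obtain ⟨γ, hγ, hr⟩ := hl r (by simp)
    have hne : α ≠ γ := by
      rintro rfl
      exact hsl (by simp [Subtype.ext (hs.trans hr.symm)])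
    rw [List.prod_cons, coe_mul_apply, hr,
      hf.apply_reflection hγ hα hne (hΔ.subset_rootSet hγ).1]
    exact ih (fun a ha => hl a (by simp [ha])) fun h => hsl (by simp [h])

/-- At the first occurrence of `s`, the root `γ = l₁ α` and its image `v⁻¹ γ` both have
`α`-coordinate 1, hence are positive. So the reflection in `γ` lengthens `v`, yet it also deletes a
letter. -/
theorem IsSimpleRootSystem.notMem_of_isReducedWordFor (hΔ : IsSimpleRootSystem W Δ)
    (hf : IsDualFamily Δ f) (hW : IsFiniteReflectionGroup W) {v s : W} {α : V} (hα : α ∈ Δ)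
    (hs : (s : V ≃ₗᵢ[ℝ] V) = hyperplaneReflection α)
    (hv : ∀ x, f α ((v : V ≃ₗᵢ[ℝ] V) x) = f α x) {l : List W}
    (hl : IsReducedWordFor (simpleReflections W Δ) l v) : s ∉ l := by
  intro hsl
  obtain ⟨l₁, l₂, rfl, hs₁⟩ := List.eq_append_cons_of_mem hsl
  obtain ⟨⟨hl, rfl⟩, hlen⟩ := hl
  have hα' := hΔ.subset_rootSet hα
  have h1 : f α ((l₁.prod : V ≃ₗᵢ[ℝ] V) α) = 1 := by
    rw [hΔ.apply_prod hf (fun a ha => hl a (by simp [ha])) hα hs hs₁, hf.1 α hα]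
  set γ := (l₁.prod : V ≃ₗᵢ[ℝ] V) α with hγdef
  have hγ : γ ∈ rootSet W := map_mem_rootSet hα' _
  have hpos := hΔ.mem_span_of_pos hf hγ hα (by rw [h1]; exact zero_lt_one)
  have h2 := hΔ.wordLength_lt_mul hf hW (t := ⟨_, hγ.2⟩) (g := (l₁ ++ s :: l₂).prod) hγ hpos rfl
    (hΔ.mem_span_of_pos hf (map_mem_rootSet hγ _) hα (by
      rw [← hv, ← (coe_inv_apply_eq_iff _ γ _).1 rfl, h1]; exact zero_lt_one))
  rw [mul_prod_eq_of_root hα'.1 hs rfl hγdef, ← hlen] at h2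
  have h3 : wordLength (simpleReflections W Δ) (l₁ ++ l₂).prod ≤ (l₁ ++ l₂).length := by
    refine wordLength_le_length ⟨fun a ha => hl a ?_, rfl⟩
    simp only [List.mem_append, List.mem_cons] at ha ⊢
    tauto
  simp only [List.length_append, List.length_cons] at h2 h3
  omega

/-- A fixed vector of a product of distinct simple reflections is fixed by each of them. -/
theorem IsSimpleRootSystem.apply_eq_self_of_mem (hΔ : IsSimpleRootSystem W Δ)
    (hf : IsDualFamily Δ f) {l : List W} (hl : ∀ s ∈ l, s ∈ simpleReflections W Δ)
    (hnd : l.Nodup) {x : V} (hx : (l.prod : V ≃ₗᵢ[ℝ] V) x = x) :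
    ∀ s ∈ l, (s : V ≃ₗᵢ[ℝ] V) x = x := by
  induction l with
  | nil => simp
  | cons r l ih =>
    obtain ⟨γ, hγ, hr⟩ := hl r (by simp)
    have hγ' := (hΔ.subset_rootSet hγ).1
    have hl' : ∀ s ∈ l, s ∈ simpleReflections W Δ := fun a ha => hl a (by simp [ha])
    rw [List.nodup_cons] at hnd
    have h1 : hyperplaneReflection γ x = (l.prod : V ≃ₗᵢ[ℝ] V) x := by
      rw [List.prod_cons, coe_mul_apply, eq_comm, ← coe_inv_apply_eq_iff, Subgroup.coe_inv, hr,
        hyperplaneReflection_inv] at hx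
      exact hx
    -- The other letters preserve the `γ`-coordinate, whereas the reflection in `γ` changes it by `2
    -- * inner ℝ γ x`.
    have h2 : inner ℝ γ x = 0 := by
      have := hΔ.apply_prod hf hl' hγ hr hnd.1 x
      rw [← h1, hyperplaneReflection_apply hγ', map_sub, map_smul, hf.1 γ hγ, smul_eq_mul] at this
      linarith
    have h3 := (hyperplaneReflection_eq_self_iff hγ' x).2 h2
    intro s hsl
    rcases List.mem_cons.1 hsl with rfl | hsl
    · rw [hr, h3]
    · exact ih hl' hnd.2 (h1.symm.trans h3) s hsl

theorem exists_mem_of_map_eq {R : List V} {l : List W}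
    (h : R.map hyperplaneReflection = l.map Subtype.val) (hR : ∀ α ∈ R, α ∈ rootSet W) {t : W}
    (ht : t ∈ l) : ∃ α ∈ R, ‖α‖ = 1 ∧ (t : V ≃ₗᵢ[ℝ] V) = hyperplaneReflection α := by
  have h1 : (t : V ≃ₗᵢ[ℝ] V) ∈ R.map hyperplaneReflection := h ▸ List.mem_map_of_mem ht
  obtain ⟨α, hα, h2⟩ := List.mem_map.1 h1
  exact ⟨α, hα, (hR α hα).1, h2.symm⟩

/-- If `v k` is a factorization of a product of distinct simple reflections which is minimal for
the reflection length, then `v` preserves the coordinates of all simple roots that do not occur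
in this product. -/
theorem IsSimpleRootSystem.apply_eq_of_mul_eq_prod [FiniteDimensional ℝ V]
    (hΔ : IsSimpleRootSystem W Δ) (hf : IsDualFamily Δ f)
    (hT : ∀ g : W, ∃ l, IsWordFor (reflectionSet W) l g) {l : List W}
    (hl : ∀ s ∈ l, s ∈ simpleReflections W Δ) (hnd : l.Nodup) {s : W} {α : V} (hα : α ∈ Δ)
    (hs : (s : V ≃ₗᵢ[ℝ] V) = hyperplaneReflection α) (hsl : s ∉ l) {v k : W}
    (hvk : v * k = l.prod)
    (hlen : wordLength (reflectionSet W) v + wordLength (reflectionSet W) k ≤ l.length) (x : V) :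
    f α ((v : V ≃ₗᵢ[ℝ] V) x) = f α x := by
  classical
  obtain ⟨R, hR, hRl⟩ := exists_list_roots hl
  obtain ⟨lv, hlv, hlv'⟩ := exists_isReducedWordFor hT v
  obtain ⟨lk, hlk, hlk'⟩ := exists_isReducedWordFor hT k
  obtain ⟨Q, hQ, hQl⟩ := exists_list_roots (l := lv ++ lk) (hlv.append hlk).1
  have hRfin : Module.finrank ℝ (Submodule.span ℝ {γ | γ ∈ R}) = l.length := by
    have h1 : R.Nodup := .of_map hyperplaneReflection (by
      rw [hRl]; exact hnd.map Subtype.val_injective)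
    have h2 : {γ | γ ∈ R} = (R.toFinset : Set V) := by ext; simp
    rw [h2, finrank_span_finset_eq_card, List.toFinset_card_of_nodup h1,
      ← List.length_map hyperplaneReflection, hRl, List.length_map]
    exact hΔ.linearIndepOn.mono fun γ hγ => hR γ (by simpa using hγ)
  have hQfin : Module.finrank ℝ (Submodule.span ℝ {γ | γ ∈ Q}) ≤ l.length := by
    have h2 : {γ | γ ∈ Q} = (Q.toFinset : Set V) := by ext; simp
    have h3 : Q.length = lv.length + lk.length := by
      rw [← List.length_map hyperplaneReflection, hQl, List.length_map, List.length_append]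
    rw [h2]
    refine (finrank_span_finset_le_card (R := ℝ) Q.toFinset).trans (Q.toFinset_card_le.trans ?_)
    omega
  -- Dually: a vector orthogonal to `Q` is fixed by the product, hence by each distinct simple
  -- factor, hence orthogonal to `R`. The dimension bounds then give equality.
  have hle : Submodule.span ℝ {γ | γ ∈ R} ≤ Submodule.span ℝ {γ | γ ∈ Q} := by
    rw [← Submodule.orthogonal_le_orthogonal_iff]
    intro y hy
    have h1 : (l.prod : V ≃ₗᵢ[ℝ] V) y = y := by
      rw [← hvk, ← (hlv.append hlk).2]
      exact apply_eq_self_of_word (fun t ht => exists_mem_of_map_eq hQl hQ ht)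
        fun γ hγ => hy γ (Submodule.subset_span hγ)
    have h2 : Submodule.span ℝ {γ | γ ∈ R} ≤ (Submodule.span ℝ {y})ᗮ := by
      rw [Submodule.span_le]
      intro γ hγ
      have h3 : hyperplaneReflection γ ∈ l.map Subtype.val := hRl ▸ List.mem_map_of_mem hγ
      obtain ⟨t, ht, h4⟩ := List.mem_map.1 h3
      have h5 := hΔ.apply_eq_self_of_mem hf hl hnd h1 t ht
      rw [h4, hyperplaneReflection_eq_self_iff (hΔ.subset_rootSet (hR γ hγ)).1] at h5
      exact Submodule.mem_orthogonal_singleton_iff_inner_left.2 h5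
    exact fun γ hγ => Submodule.mem_orthogonal_singleton_iff_inner_left.1 (h2 hγ)
  have heq := Submodule.eq_of_le_of_finrank_le hle (hQfin.trans hRfin.ge)
  have h1 : (v : V ≃ₗᵢ[ℝ] V) x - x ∈ Submodule.span ℝ {γ | γ ∈ Q} := by
    rw [← hlv.2]
    exact sub_mem_span_of_word
      (fun t ht => exists_mem_of_map_eq hQl hQ (List.mem_append_left _ ht)) x
  have h2 : Submodule.span ℝ {γ | γ ∈ R} ≤ LinearMap.ker (f α) := by
    rw [Submodule.span_le]
    intro γ hγ
    have h3 : hyperplaneReflection γ ∈ l.map Subtype.val := hRl ▸ List.mem_map_of_mem hγ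
    obtain ⟨t, ht, h4⟩ := List.mem_map.1 h3
    refine hf.2 α hα γ (hR γ hγ) ?_
    rintro rfl
    exact hsl (Subtype.ext (hs.trans h4.symm) ▸ ht)
  rw [← heq] at h1
  have h3 : f α _ = 0 := h2 h1
  rwa [map_sub, sub_eq_zero] at h3

/-- If `β` is a positive root made negative by the inverse of a Coxeter element `c` and the
reflection in `β` carries `v` to an element `w` covering `v` in the poset of noncrossing
partitions, then `v` preserves a coordinate of a simple root at which `β` has coefficient `1`. -/
theorem IsSimpleRootSystem.exists_apply_eq_of_nccovBy [FiniteDimensional ℝ V]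
    (hΔ : IsSimpleRootSystem W Δ) (hf : IsDualFamily Δ f)
    (hT : ∀ g : W, ∃ l, IsWordFor (reflectionSet W) l g) {c v w : W}
    (hc : IsStandardCoxeterElement (simpleReflections W Δ) c)
    (hvw : NCCovBy (reflectionSet W) c v w) {β : V} (hβ : β ∈ rootSet W)
    (hβ' : β ∈ Submodule.span ℝ≥0 Δ)
    (ht : ((w * v⁻¹ : W) : V ≃ₗᵢ[ℝ] V) = hyperplaneReflection β)
    (h : -((c⁻¹ : W) : V ≃ₗᵢ[ℝ] V) β ∈ Submodule.span ℝ≥0 Δ) :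
    ∃ α ∈ Δ, f α β = 1 ∧ ∀ x, f α ((v : V ≃ₗᵢ[ℝ] V) x) = f α x := by
  obtain ⟨l, hnd, hl, rfl⟩ := hc
  obtain ⟨l₁, s, l₂, rfl, α, hα, hs, h1⟩ := hΔ.exists_eq_append hf (fun s hs => (hl s).1 hs) hβ hβ' h
  have hα' := hΔ.subset_rootSet hα
  have hsub : ∀ a ∈ l₁ ++ l₂, a ∈ simpleReflections W Δ := fun a ha => (hl a).1 (by
    simp only [List.mem_append, List.mem_cons] at ha ⊢
    tauto)
  obtain ⟨hs', hnd'⟩ := List.nodup_cons.1 (List.nodup_middle.1 hnd)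
  refine ⟨α, hα, ?_, ?_⟩
  · rw [h1, hΔ.apply_prod hf (fun a ha => hsub a (by simp [ha])) hα hs fun h => hs' (by simp [h]),
      hf.1 α hα]
  · refine hΔ.apply_eq_of_mul_eq_prod hf hT hsub hnd' hα hs hs'
      (k := w⁻¹ * (l₁ ++ s :: l₂).prod) ?_ ?_
    · have htt : (w * v⁻¹)⁻¹ = w * v⁻¹ :=
        Subtype.ext (by rw [Subgroup.coe_inv, ht, hyperplaneReflection_inv])
      rw [← mul_prod_eq_of_root (l₂ := l₂) hα'.1 hs ht h1, ← htt, mul_inv_rev, inv_inv, mul_assoc]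
    -- The cover raises the reflection length by one, which pays for the deleted letter; only the
    -- bound of the reflection length of `c` by its number of letters is needed.
    · have h2 := (hvw.exists_eq_mul hT).2
      have h3 : AbsLE (reflectionSet W) w _ := hvw.2.1
      have h4 : wordLength (reflectionSet W) (l₁ ++ s :: l₂).prod ≤ (l₁ ++ s :: l₂).length := by
        refine wordLength_le_length ⟨fun a ha => ?_, rfl⟩
        obtain ⟨γ, hγ, h⟩ := (hl a).1 ha
        exact ⟨γ, hΔ.subset_rootSet hγ, h⟩
      simp only [AbsLE, List.length_append, List.length_cons] at h3 h4 ⊢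
      omega

end Roots

theorem mainTheorem10 {V : Type*} [NormedAddCommGroup V] [InnerProductSpace ℝ V]
    [FiniteDimensional ℝ V]
    (W : Subgroup (V ≃ₗᵢ[ℝ] V)) (hW : IsFiniteReflectionGroup W)
    (S : Set W) (hS : IsSimpleSystem W S)
    (c : W) (hc : IsStandardCoxeterElement S c)
    (v w : W) (hvw : NCCovBy (reflectionSet W) c v w) :
    (BruhatLT S (reflectionSet W) w v →
      BruhatLT S (reflectionSet W) (kreweras c w) (kreweras c v)) ∧
    (HasFullSupport S v →
      BruhatLT S (reflectionSet W) (kreweras c w) (kreweras c v) →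
      BruhatLT S (reflectionSet W) w v) := by
  obtain ⟨Δ, hΔ, hSΔ⟩ := hS
  obtain rfl : S = simpleReflections W Δ := hSΔ
  obtain ⟨f, hf⟩ := exists_isDualFamily hΔ.linearIndepOn
  have hT : ∀ g : W, ∃ l, IsWordFor (reflectionSet W) l g :=
    exists_isWordFor_of_closure_eq_top hW.closure_eq_top fun _ => inv_mem_reflectionSet
  have ht := (hvw.exists_eq_mul hT).1
  have ht' : w * v⁻¹ ∈ reflectionSet W := by
    simpa [mul_assoc] using conj_mem_reflectionSet ht v
  obtain ⟨β, hβ, hβ', hβt⟩ := mem_span_or_of_mem_reflectionSet hΔ ht'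
  set δ := ((v⁻¹ : W) : V ≃ₗᵢ[ℝ] V) β with hδdef
  have hδ : δ ∈ rootSet W := map_mem_rootSet hβ _
  have hvδ : (v : V ≃ₗᵢ[ℝ] V) δ = β := ((coe_inv_apply_eq_iff v β δ).1 rfl).symm
  have htt : (w * v⁻¹)⁻¹ = w * v⁻¹ :=
    Subtype.ext (by rw [Subgroup.coe_inv, hβt, hyperplaneReflection_inv])
  have hw : w * v⁻¹ * v = w := by group
  have hK : v⁻¹ * (w * v⁻¹) * v * kreweras c v = kreweras c w := by
    rw [← htt, kreweras, kreweras]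
    group
  have hKt : ((v⁻¹ * (w * v⁻¹) * v : W) : V ≃ₗᵢ[ℝ] V) = hyperplaneReflection δ := by
    rw [hδdef, hyperplaneReflection_map hβ.1, ← hβt]
    simp
  have hKδ : (((kreweras c v)⁻¹ : W) : V ≃ₗᵢ[ℝ] V) δ = ((c⁻¹ : W) : V ≃ₗᵢ[ℝ] V) β := by
    rw [kreweras, mul_inv_rev, inv_inv, coe_mul_apply, hvδ]
  have hcβ := hΔ.mem_or_neg_mem _ (map_mem_rootSet hβ c⁻¹)
  constructor
  · intro h
    have h1 := h.wordLength_lt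
    have h2 : -δ ∈ Submodule.span ℝ≥0 Δ := by
      refine (hΔ.mem_or_neg_mem δ hδ).resolve_left fun h2 => ?_
      have h3 := hΔ.wordLength_lt_mul hf hW hβ hβ' hβt (g := v) h2
      rw [hw] at h3
      omega
    refine bruhatLT_of_wordLength_lt ?_ ?_
    · rw [← hK, mul_inv_cancel_right]
      exact ⟨δ, hδ, hKt⟩
    · rcases hcβ with h3 | h3
      -- Here the positive root is `-δ`, and `K(v)⁻¹` sends it to the negative root `-c⁻¹ β`.
      · rw [← hK]
        refine hΔ.wordLength_mul_lt hf hW (neg_mem_rootSet hδ) h2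
          (by rw [hKt, hyperplaneReflection_neg]) ?_
        rwa [map_neg, neg_neg, hKδ]
      · obtain ⟨α, hα, h4, h5⟩ := hΔ.exists_apply_eq_of_nccovBy hf hT hc hvw hβ hβ' hβt h3
        -- The `α`-coordinate of `δ` equals that of `v δ = β`, namely 1, so `-δ` cannot be positive.
        have h6 := h5 δ
        rw [hvδ, h4] at h6
        have h7 := hf.nonneg hα h2
        rw [map_neg, ← h6] at h7
        norm_num at h7
  · intro hfull h
    have h1 := h.wordLength_lt
    refine bruhatLT_of_wordLength_lt ht' ?_
    rcases hΔ.mem_or_neg_mem δ hδ with h2 | h2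
    · rcases hcβ with h3 | h3
      · have h4 := hΔ.wordLength_lt_mul hf hW hδ h2 hKt (g := kreweras c v) (by rwa [hKδ])
        rw [hK] at h4
        omega
      · obtain ⟨α, hα, -, h5⟩ := hΔ.exists_apply_eq_of_nccovBy hf hT hc hvw hβ hβ' hβt h3
        -- Full support puts the reflection in `α` into a reduced word of `v`, although `v`
        -- preserves the `α`-coordinate.
        have h6 : (⟨hyperplaneReflection α, (hΔ.subset_rootSet hα).2⟩ : W) ∈
            wordSupport (simpleReflections W Δ) v := by
          rw [hfull]
          exact ⟨α, hα, rfl⟩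
        obtain ⟨l, hl, hmem⟩ := h6
        exact absurd hmem (hΔ.notMem_of_isReducedWordFor hf hW hα rfl h5 hl)
    · have h3 := hΔ.wordLength_mul_lt hf hW hβ hβ' hβt (g := v) h2
      rwa [hw] at h3
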